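/- Let $\overrightarrow{G}=(V,E)$ be a finite simple digraph on $n$ vertices (no loops, at most one edge from $u$ to $v$ for each ordered pair $(u,v)$; two opposite edges between the same vertices are allowed), and let $G$ be its underlying simple undirected graph, in which a pair of opposite edges becomes a single edge. A proper coloring is a map $\kappa$ from $V$ to the positive integers with $\kappa(u)\neq\kappa(v)$ whenever $u,v$ are adjacent in $G$, and $\operatorname{asc}(\kappa)$ is the number of directed edges $(u,v)\in E$ with $\kappa(u)<\kappa(v)$. Let $$X_{\overrightarrow{G}}(\mathbf{x},t)=\sum_{\kappa\text{ proper}}t^{\operatorname{asc}(\kappa)}\prod_{v\in V}x_{\kappa(v)},$$ a formal power series in $x_1,x_2,\dots$ with coefficients in $\mathbb{Q}[t]$. Suppose that $X_{\overrightarrow{G}}(\mathbf{x},t)$ is symmetric in the variables $x_1,x_2,\dots$, and that it has the expansion $$X_{\overrightarrow{G}}(\mathbf{x},t)=\sum_{\lambda\vdash n}c_\lambda(t)\,e_\lambda(\mathbf{x}),\qquad c_\lambda(t)\in\mathbb{Q}[t],$$ in the elementary symmetric functions $e_\lambda=\prod_i e_{\lambda_i}$. Then for every integer $k\ge 0$,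 $$\sum_{\substack{\lambda\vdash n\\ \ell(\lambda)=k}}c_\lambda(t)=\sum_{D\in AO_k(G)}t^{\operatorname{asc}_{\overrightarrow{G}}(D)},$$ where $\ell(\lambda)$ is the number of parts of $\lambda$, $AO_k(G)$ is the set of acyclic orientations of $G$ with exactly $k$ sinks (vertices with no outgoing edge), and $\operatorname{asc}_{\overrightarrow{G}}(D)$ is the number of directed edges of $\overrightarrow{G}$ that are oriented as in $D$. -/

import Mathlib

open scoped Polynomial

noncomputable section

namespace ChromaticQSym

/-- Proper colorings of a digraph by positive integers, i.e. proper colorings of its underlying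
undirected graph (a pair of opposite directed edges gives one undirected edge). -/
abbrev ProperColoring {V : Type*} (G : Digraph V) : Type _ :=
  G.toSimpleGraphInclusive.Coloring ℕ+

open Classical in
/-- The number of ascents of a coloring `κ`: directed edges `(u, v)` with `κ u < κ v`. -/
def asc {V : Type*} [Fintype V] (G : Digraph V) (κ : ProperColoring G) : ℕ :=
  (Finset.univ.filter fun p : V × V => G.Adj p.1 p.2 ∧ κ p.1 < κ p.2).card

/-- The exponent vector of the monomial `x_κ = ∏ v, x_{κ v}`. -/
def content {V : Type*} [Fintype V] {G : Digraph V} (κ : ProperColoring G) : ℕ+ →₀ ℕ :=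
  ∑ v, Finsupp.single (κ v) 1

/-- Only finitely many proper colorings `κ` have a given monomial `x_κ`. -/
theorem finite_content_eq {V : Type*} [Fintype V] (G : Digraph V) (m : ℕ+ →₀ ℕ) :
    {κ : ProperColoring G | content κ = m}.Finite := by
  classical
  have h : (Set.univ.pi fun _ : V => (m.support : Set ℕ+)).Finite :=
    Set.Finite.pi fun _ => m.support.finite_toSet
  refine Set.Finite.of_finite_image (f := fun κ : ProperColoring G => (κ : V → ℕ+))
    (h.subset ?_) (DFunLike.coe_injective.injOn)
  rintro _ ⟨κ, hκ, rfl⟩ v -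
  have hκ' : content κ = m := hκ
  have h1 : Finsupp.single (κ v) 1 (κ v) ≤ ∑ w, Finsupp.single (κ w) 1 (κ v) :=
    Finset.single_le_sum (f := fun w => Finsupp.single (κ w) 1 (κ v))
      (fun _ _ => Nat.zero_le _) (Finset.mem_univ v)
  have h2 : m (κ v) = ∑ w, Finsupp.single (κ w) 1 (κ v) := by
    rw [← hκ', content, Finsupp.finsetSum_apply]
  rw [Finsupp.single_eq_same] at h1
  simp only [Finset.mem_coe, Finsupp.mem_support_iff]
  omega

/-- The chromatic quasisymmetric function `∑_κ t ^ asc(κ) x_κ` of a finite digraph, a formal power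
series in `x₁, x₂, …` over `ℚ[t]`: the coefficient of a monomial `x ^ m` is the sum of `t ^ asc(κ)`
over the finitely many proper colorings `κ` with `x_κ = x ^ m`. -/
def chromQSym {V : Type*} [Fintype V] (G : Digraph V) : MvPowerSeries ℕ+ ℚ[X] :=
  fun m => ∑ κ ∈ (finite_content_eq G m).toFinset, (Polynomial.X : ℚ[X]) ^ asc G κ

/-- A power series is symmetric if it is invariant under all permutations of the variables. -/
def IsSymm {R : Type*} [Semiring R] (f : MvPowerSeries ℕ+ R) : Prop :=
  ∀ (σ : Equiv.Perm ℕ+) (m : ℕ+ →₀ ℕ),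
    MvPowerSeries.coeff (m.equivMapDomain σ) f = MvPowerSeries.coeff m f

open Classical in
/-- The elementary symmetric function `e_d`, the sum of the squarefree monomials `∏ i ∈ s, x_i`
over all `d`-element sets `s` of positive integers. -/
def elem (R : Type*) [CommSemiring R] (d : ℕ) : MvPowerSeries ℕ+ R :=
  fun m => if ∃ s : Finset ℕ+, s.card = d ∧ ∑ i ∈ s, Finsupp.single i 1 = m then 1 else 0

/-- The elementary symmetric function `e_μ = ∏ i, e_{μ_i}` of a partition `μ`. -/
def elemPart (R : Type*) [CommSemiring R] {n : ℕ} (μ : n.Partition) : MvPowerSeries ℕ+ R :=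
  (μ.parts.map (elem R)).prod

/-- `D` is an orientation of the simple graph `H`: every edge of `H` gets exactly one of its two
directions, and `D` has no other edges. -/
def IsOrientation {V : Type*} (H : SimpleGraph V) (D : Digraph V) : Prop :=
  (∀ u v, D.Adj u v → H.Adj u v) ∧ ∀ u v, H.Adj u v → Xor (D.Adj u v) (D.Adj v u)

/-- `D` has no directed cycles. -/
def IsAcyclic {V : Type*} (D : Digraph V) : Prop :=
  ∀ v, ¬ Relation.TransGen D.Adj v v

open Classical in
/-- The sinks of `D`: vertices without outgoing edges. -/
def sinks {V : Type*} [Fintype V] (D : Digraph V) : Finset V :=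
  Finset.univ.filter fun v => ∀ w, ¬ D.Adj v w

open Classical in
/-- The acyclic orientations of `H` with exactly `k` sinks. -/
def acyclicOrientations {V : Type*} [Fintype V] (H : SimpleGraph V) (k : ℕ) :
    Finset (Digraph V) :=
  Finset.univ.filter fun D => IsOrientation H D ∧ IsAcyclic D ∧ (sinks D).card = k

open Classical in
/-- The number of directed edges of `G` that are oriented as in `D`. -/
def ascOrientation {V : Type*} [Fintype V] (G D : Digraph V) : ℕ :=
  (Finset.univ.filter fun p : V × V => G.Adj p.1 p.2 ∧ D.Adj p.1 p.2).card

end ChromaticQSym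

end

/-! The specialization `x_i = 1` for `i ≤ m`, `x_{m+1} = z`, all later variables `0`, turns both
sides of the `e`-expansion into polynomial functions of `m`, which are compared at `m = -1`.

On the elementary side `e_d` becomes `C(m,d) + z C(m,d-1)`, with value `(-1)^d (1 - z)` at `m = -1`.
Hence `e_λ` contributes `(-1)^n (1 - z)^ℓ(λ)`, which records the number of parts (`subst_elemPart`,
`extrapolatesTo_choose`).

On the coloring side each proper coloring orients edges towards the larger color, which groups
colorings by acyclic orientation (`sum_coloring_eq_sum_orientation`). For fixed `D` the class of
color `m + 1` is a set `W` of sinks, and the rest is a strict coloring by `m` colors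
(`sum_strictColorings_succ`). Reciprocity gives `(-1)^(n - |W|)` for the rest at `m = -1`, and
summing `z^|W|` over sets of sinks gives `(-1)^n (1 - z)^#sinks`.

With `y = 1 - z` an indeterminate, the coefficients of `y^k` are the claim. -/

namespace ChromaticQSym

/-! ### Polynomial functions on the naturals and their value at `-1` -/

section Extrapolation

variable {R : Type*} [CommRing R]

/-- Bernoulli polynomials telescope: `B_{n+1}(X + 1) - B_{n+1}(X) = (n + 1) X^n`. Dividing by `n +
1` is where the `ℚ`-algebra structure enters. -/
theorem exists_comp_add_one_sub [Algebra ℚ R] (p : R[X]) :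
    ∃ q : R[X], q.comp (Polynomial.X + 1) - q = p := by
  induction p using Polynomial.induction_on' with
  | add p₁ p₂ h₁ h₂ =>
    obtain ⟨q₁, rfl⟩ := h₁
    obtain ⟨q₂, rfl⟩ := h₂
    exact ⟨q₁ + q₂, by rw [Polynomial.add_comp]; ring⟩
  | monomial n a =>
    have hb := congrArg (Polynomial.map (algebraMap ℚ R))
      (Polynomial.bernoulli_comp_one_add_X (n + 1))
    simp only [Polynomial.map_comp, Polynomial.map_add, Polynomial.map_one, Polynomial.map_X,
      nsmul_eq_mul, Polynomial.map_mul, Polynomial.map_natCast, Polynomial.map_pow,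
      add_tsub_cancel_right] at hb
    refine ⟨Polynomial.C (a * algebraMap ℚ R ((n + 1 : ℕ) : ℚ)⁻¹) *
      (Polynomial.bernoulli (n + 1)).map (algebraMap ℚ R), ?_⟩
    have hinv : algebraMap ℚ R ((n + 1 : ℕ) : ℚ)⁻¹ * ((n + 1 : ℕ) : R) = 1 := by
      rw [← map_natCast (algebraMap ℚ R), ← map_mul, inv_mul_cancel₀ (by positivity), map_one]
    rw [Polynomial.mul_comp, Polynomial.C_comp, add_comm Polynomial.X, hb, mul_add,
      add_sub_cancel_left, ← mul_assoc, ← map_natCast (Polynomial.C : R →+* R[X]),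
      ← Polynomial.C_mul, mul_assoc a, hinv, mul_one, Polynomial.C_mul_X_pow_eq_monomial]

/-- `f` is a polynomial function on the natural numbers whose value at `-1` is `a`. -/
def ExtrapolatesTo (f : ℕ → R) (a : R) : Prop :=
  ∃ p : R[X], (∀ m : ℕ, p.eval (m : R) = f m) ∧ p.eval (-1) = a

theorem ExtrapolatesTo.const (a : R) : ExtrapolatesTo (fun _ => a) a :=
  ⟨Polynomial.C a, by simp, by simp⟩

theorem ExtrapolatesTo.add {f g : ℕ → R} {a b : R} (hf : ExtrapolatesTo f a)
    (hg : ExtrapolatesTo g b) : ExtrapolatesTo (fun m => f m + g m) (a + b) := by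
  obtain ⟨p, hp, rfl⟩ := hf
  obtain ⟨q, hq, rfl⟩ := hg
  exact ⟨p + q, by simp [hp, hq], by simp⟩

theorem ExtrapolatesTo.mul {f g : ℕ → R} {a b : R} (hf : ExtrapolatesTo f a)
    (hg : ExtrapolatesTo g b) : ExtrapolatesTo (fun m => f m * g m) (a * b) := by
  obtain ⟨p, hp, rfl⟩ := hf
  obtain ⟨q, hq, rfl⟩ := hg
  exact ⟨p * q, by simp [hp, hq], by simp⟩

theorem ExtrapolatesTo.sum {ι : Type*} {s : Finset ι} {f : ι → ℕ → R} {a : ι → R}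
    (h : ∀ i ∈ s, ExtrapolatesTo (f i) (a i)) :
    ExtrapolatesTo (fun m => ∑ i ∈ s, f i m) (∑ i ∈ s, a i) := by
  classical
  induction s using Finset.induction_on with
  | empty => simpa using ExtrapolatesTo.const (0 : R)
  | insert i s hi ih =>
    simp only [Finset.sum_insert hi]
    exact (h i (Finset.mem_insert_self i s)).add
      (ih fun j hj => h j (Finset.mem_insert_of_mem hj))

theorem ExtrapolatesTo.multiset_prod {ι : Type*} {s : Multiset ι} {f : ι → ℕ → R} {a : ι → R}
    (h : ∀ i ∈ s, ExtrapolatesTo (f i) (a i)) :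
    ExtrapolatesTo (fun m => (s.map fun i => f i m).prod) (s.map a).prod := by
  induction s using Multiset.induction_on with
  | empty => simpa using ExtrapolatesTo.const (1 : R)
  | cons i s ih =>
    simp only [Multiset.map_cons, Multiset.prod_cons]
    exact (h i (Multiset.mem_cons_self i s)).mul
      (ih fun j hj => h j (Multiset.mem_cons_of_mem hj))

/-- An indefinite sum of a polynomial is a polynomial. The recursion then persists at `m = -1`,
where it reads `f(0) = f(-1) + a`. -/
theorem ExtrapolatesTo.of_diff [Algebra ℚ R] {f g : ℕ → R} {a : R} (hg : ExtrapolatesTo g a)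
    (h : ∀ m, f (m + 1) = f m + g m) : ExtrapolatesTo f (f 0 - a) := by
  obtain ⟨p, hp, rfl⟩ := hg
  obtain ⟨q, rfl⟩ := exists_comp_add_one_sub p
  simp only [Polynomial.eval_sub, Polynomial.eval_comp, Polynomial.eval_add, Polynomial.eval_X,
    Polynomial.eval_one] at hp
  refine ⟨q + Polynomial.C (f 0 - q.eval 0), fun m => ?_, ?_⟩
  · induction m with
    | zero => simp
    | succ m ih =>
      have := hp m
      rw [h, ← ih, ← this]
      simp only [Nat.cast_add, Nat.cast_one, Polynomial.eval_add, Polynomial.eval_C]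
      ring
  · simp only [Polynomial.eval_sub, Polynomial.eval_add, Polynomial.eval_C,
      Polynomial.eval_comp, Polynomial.eval_X, Polynomial.eval_one, neg_add_cancel]
    ring

theorem ExtrapolatesTo.unique [Algebra ℚ R] [IsDomain R] {f : ℕ → R} {a b : R}
    (ha : ExtrapolatesTo f a)
    (hb : ExtrapolatesTo f b) : a = b := by
  obtain ⟨p, hp, rfl⟩ := ha
  obtain ⟨q, hq, rfl⟩ := hb
  have : CharZero R := algebraRat.charZero R
  rw [Polynomial.eq_of_infinite_eval_eq p q]
  refine (Set.infinite_range_of_injective (Nat.cast_injective (R := R))).mono ?_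
  rintro _ ⟨m, rfl⟩
  simp [hp, hq]

/-- Pascal's rule is the difference equation, and `C(0, d + 1) = 0`, so each step only flips the
sign. -/
theorem extrapolatesTo_choose [Algebra ℚ R] (d : ℕ) :
    ExtrapolatesTo (fun m => (m.choose d : R)) ((-1) ^ d) := by
  induction d with
  | zero => simpa using ExtrapolatesTo.const (1 : R)
  | succ d ih =>
    convert ih.of_diff (f := fun m => (m.choose (d + 1) : R)) fun m => ?_ using 1
    · simp [pow_succ]
    · rw [Nat.choose_succ_succ]
      push_cast
      ring

end Extrapolation

/-- After the common sign `(-1)^|S \ T|` is factored out, this is the binomial expansion of `(z -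
1)^|T|`. The case `z = 1` drives reciprocity; general `z` counts sinks. -/
theorem sum_powerset_pow_mul_neg_one_pow {ι R : Type*} [CommRing R] [DecidableEq ι] (z : R)
    {T S : Finset ι} (hTS : T ⊆ S) :
    ∑ W ∈ T.powerset, z ^ W.card * (-1) ^ (S \ W).card = (-1) ^ S.card * (1 - z) ^ T.card := by
  have h : ∀ W ∈ T.powerset, z ^ W.card * (-1 : R) ^ (S \ W).card =
      (-1) ^ (S \ T).card * (z ^ W.card * (-1) ^ (T.card - W.card)) := fun W hW => by
    have hWT := Finset.mem_powerset.1 hW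
    have h₁ := Finset.card_le_card hWT
    have h₂ := Finset.card_le_card hTS
    rw [Finset.card_sdiff_of_subset (hWT.trans hTS), Finset.card_sdiff_of_subset hTS,
      mul_left_comm, ← pow_add]
    congr 2
    omega
  rw [Finset.sum_congr rfl h, ← Finset.mul_sum, Finset.sum_pow_mul_eq_add_pow,
    Finset.card_sdiff_of_subset hTS, show z + -1 = -1 * (1 - z) by ring, mul_pow, ← mul_assoc,
    ← pow_add, Nat.sub_add_cancel (Finset.card_le_card hTS)]

/-! ### Strict colorings of an acyclic digraph and reciprocity -/

section StrictColorings

variable {V : Type*} [Fintype V]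

open Classical in
/-- Maps that color the vertices of `S` by `1, …, m`, strictly increasing along the edges of `D`
inside `S`, and that vanish outside `S`. -/
noncomputable def strictColorings (D : Digraph V) (S : Finset V) (m : ℕ) : Finset (V → ℕ) :=
  (Fintype.piFinset fun v => if v ∈ S then Finset.Icc 1 m else {0}).filter
    fun κ => ∀ u ∈ S, ∀ v ∈ S, D.Adj u v → κ u < κ v

open Classical in
/-- The vertices of `S` without outgoing edges inside `S`. -/
noncomputable def sinksIn (D : Digraph V) (S : Finset V) : Finset V :=
  S.filter fun v => ∀ w ∈ S, ¬ D.Adj v w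

theorem mem_strictColorings {D : Digraph V} {S : Finset V} {m : ℕ} {κ : V → ℕ} :
    κ ∈ strictColorings D S m ↔ (∀ v ∈ S, 1 ≤ κ v ∧ κ v ≤ m) ∧ (∀ v ∉ S, κ v = 0) ∧
      ∀ u ∈ S, ∀ v ∈ S, D.Adj u v → κ u < κ v := by
  classical
  simp only [strictColorings, Finset.mem_filter, Fintype.mem_piFinset, ← and_assoc]
  refine and_congr_left fun _ => ?_
  constructor
  · intro h
    exact ⟨fun v hv => by simpa [hv] using h v, fun v hv => by simpa [hv] using h v⟩
  · rintro ⟨h₁, h₂⟩ v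
    by_cases hv : v ∈ S
    · simpa [hv] using h₁ v hv
    · simpa [hv] using h₂ v hv

theorem mem_sinksIn {D : Digraph V} {S : Finset V} {v : V} :
    v ∈ sinksIn D S ↔ v ∈ S ∧ ∀ w ∈ S, ¬ D.Adj v w := by
  classical
  simp [sinksIn]

theorem sinksIn_subset (D : Digraph V) (S : Finset V) : sinksIn D S ⊆ S :=
  fun _ h => (mem_sinksIn.1 h).1

theorem sinksIn_univ (D : Digraph V) : sinksIn D Finset.univ = sinks D := by
  classical
  ext v
  simp [mem_sinksIn, sinks]

open Classical in
/-- The vertices of the largest color form a set of sinks, and removing them leaves a strict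
coloring with one color less. -/
theorem sum_strictColorings_succ {R : Type*} [CommRing R] (z : R) (D : Digraph V) (S : Finset V)
    (m : ℕ) :
    ∑ κ ∈ strictColorings D S (m + 1), z ^ (S.filter fun v => κ v = m + 1).card =
      ∑ W ∈ (sinksIn D S).powerset, z ^ W.card * ((strictColorings D (S \ W) m).card : R) := by
  have hR : ∀ W : Finset V, z ^ W.card * ((strictColorings D (S \ W) m).card : R) =
      ∑ κ ∈ strictColorings D (S \ W) m, z ^ W.card := fun W => by
    rw [Finset.sum_const, nsmul_eq_mul, mul_comm]
  simp only [hR]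
  rw [Finset.sum_sigma']
  -- The top color is reset to `0`, the prescribed value off `S \ W`, so that recoloring `W` by `m +
  -- 1` inverts the map.
  refine Finset.sum_bij' (fun κ _ => ⟨S.filter fun v => κ v = m + 1,
      fun v => if κ v = m + 1 then 0 else κ v⟩)
    (fun x _ v => if v ∈ x.1 then m + 1 else x.2 v) ?_ ?_ ?_ ?_ ?_
  · intro κ hκ
    obtain ⟨h₁, h₂, h₃⟩ := mem_strictColorings.1 hκ
    simp only [Finset.mem_sigma, Finset.mem_powerset, mem_strictColorings]
    refine ⟨fun v hv => ?_, fun v hv => ?_, fun v hv => ?_, fun u hu v hv huv => ?_⟩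
    · rw [Finset.mem_filter] at hv
      refine mem_sinksIn.2 ⟨hv.1, fun w hw hvw => ?_⟩
      have := h₃ v hv.1 w hw hvw
      have := h₁ w hw
      omega
    · simp only [Finset.mem_sdiff, Finset.mem_filter, not_and] at hv
      have := h₁ v hv.1
      have := hv.2 hv.1
      rw [if_neg this]
      omega
    · simp only [Finset.mem_sdiff, Finset.mem_filter] at hv
      split_ifs with h
      · rfl
      · exact h₂ v fun hvS => hv ⟨hvS, fun h' => h h'.2⟩
    · simp only [Finset.mem_sdiff, Finset.mem_filter, not_and] at hu hv
      rw [if_neg (hu.2 hu.1), if_neg (hv.2 hv.1)]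
      exact h₃ u hu.1 v hv.1 huv
  · rintro ⟨W, κ⟩ hx
    simp only [Finset.mem_sigma, Finset.mem_powerset, mem_strictColorings, Finset.mem_sdiff] at hx
    obtain ⟨hW, h₁, h₂, h₃⟩ := hx
    refine mem_strictColorings.2 ⟨fun v hv => ?_, fun v hv => ?_, fun u hu v hv huv => ?_⟩
    · dsimp only
      split_ifs with h
      · omega
      · have := h₁ v ⟨hv, h⟩
        omega
    · dsimp only
      rw [if_neg fun h => hv (sinksIn_subset D S (hW h))]
      exact h₂ v fun h => hv h.1
    · have huW : u ∉ W := fun h => (mem_sinksIn.1 (hW h)).2 v hv huv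
      dsimp only
      rw [if_neg huW]
      split_ifs with h
      · have := h₁ u ⟨hu, huW⟩
        omega
      · exact h₃ u ⟨hu, huW⟩ v ⟨hv, h⟩ huv
  · intro κ hκ
    obtain ⟨h₁, h₂, h₃⟩ := mem_strictColorings.1 hκ
    funext v
    by_cases hv : v ∈ S
    · by_cases h : κ v = m + 1 <;> simp [hv, h]
    · simp [hv, h₂ v hv]
  · rintro ⟨W, κ⟩ hx
    simp only [Finset.mem_sigma, Finset.mem_powerset, mem_strictColorings, Finset.mem_sdiff] at hx
    obtain ⟨hW, h₁, h₂, h₃⟩ := hx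
    have hne : ∀ v, v ∉ W → κ v ≠ m + 1 := fun v hv h => by
      by_cases hvS : v ∈ S
      · have := h₁ v ⟨hvS, hv⟩
        omega
      · have := h₂ v fun h => hvS h.1
        omega
    rw [Sigma.mk.injEq]
    refine ⟨?_, heq_of_eq (funext fun v => ?_)⟩
    · ext v
      by_cases hv : v ∈ W
      · simp [hv, sinksIn_subset D S (hW hv)]
      · simp [hv, hne v hv]
    · by_cases hv : v ∈ W
      · simp [hv, h₂ v fun h => h.2 hv]
      · simp [hv, hne v hv]
  · intro κ _
    rfl

/-- Reachability in an acyclic digraph is a strict order; on a finite vertex set its reverse is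
well-founded, and a minimal element of `S` for the reverse has no edge into `S`. -/
theorem IsAcyclic.sinksIn_nonempty {D : Digraph V} (hD : IsAcyclic D) {S : Finset V}
    (hS : S.Nonempty) : (sinksIn D S).Nonempty := by
  have hwf : WellFounded (Function.swap (Relation.TransGen D.Adj)) := by
    have : IsTrans V (Function.swap (Relation.TransGen D.Adj)) :=
      ⟨fun _ _ _ h₁ h₂ => h₂.trans h₁⟩
    have : Std.Irrefl (Function.swap (Relation.TransGen D.Adj)) := ⟨hD⟩
    exact Finite.wellFounded_of_trans_of_irrefl _
  obtain ⟨v, hv, hmin⟩ := hwf.has_min (S : Set V) hS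
  exact ⟨v, mem_sinksIn.2 ⟨hv, fun w hw h => hmin w hw (Relation.TransGen.single h)⟩⟩

/-- Reciprocity at `-1`: the polynomial counting strict colorings by `m` colors takes the value
`(-1) ^ |S|` at `-1`. -/
theorem extrapolatesTo_card_strictColorings {R : Type*} [CommRing R] [Algebra ℚ R]
    {D : Digraph V} (hD : IsAcyclic D) (S : Finset V) :
    ExtrapolatesTo (fun m => ((strictColorings D S m).card : R)) ((-1) ^ S.card) := by
  classical
  induction S using Finset.strongInduction with
  | H S ih =>
    rcases S.eq_empty_or_nonempty with rfl | hS
    · have h : ∀ m, strictColorings D ∅ m = {0} := fun m => by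
        ext κ
        simp [mem_strictColorings, funext_iff]
      simpa [h] using ExtrapolatesTo.const (1 : R)
    · have hE : ExtrapolatesTo (fun m => ∑ W ∈ (sinksIn D S).powerset.erase ∅,
          ((strictColorings D (S \ W) m).card : R))
          (∑ W ∈ (sinksIn D S).powerset.erase ∅, (-1) ^ (S \ W).card) := by
        refine ExtrapolatesTo.sum fun W hW => ih _ ?_
        rw [Finset.mem_erase, Finset.mem_powerset] at hW
        exact Finset.sdiff_ssubset (hW.2.trans (sinksIn_subset D S))
          (Finset.nonempty_iff_ne_empty.2 hW.1)
      have hmem : ∅ ∈ (sinksIn D S).powerset := Finset.empty_mem_powerset _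
      convert hE.of_diff (f := fun m => ((strictColorings D S m).card : R)) fun m => ?_ using 1
      · have h0 : strictColorings D S 0 = ∅ := by
          obtain ⟨v, hv⟩ := hS
          refine Finset.eq_empty_of_forall_notMem fun κ hκ => ?_
          have := (mem_strictColorings.1 hκ).1 v hv
          omega
        -- Since there is a sink, the full alternating sum vanishes, so the nonempty `W` contribute
        -- `-(-1)^|S|`.
        have := sum_powerset_pow_mul_neg_one_pow (1 : R) (sinksIn_subset D S)
        rw [← Finset.add_sum_erase _ _ hmem, sub_self,
          zero_pow (hD.sinksIn_nonempty hS).card_pos.ne'] at this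
        simp only [one_pow, one_mul, Finset.sdiff_empty, mul_zero] at this
        simp only [h0, Finset.card_empty, Nat.cast_zero]
        linear_combination this
      · have := sum_strictColorings_succ (1 : R) D S m
        rw [← Finset.add_sum_erase _ _ hmem] at this
        simpa using this

-- Only the counts for `S \ W` depend on `m`; reciprocity evaluates each at `-1`, and the binomial
-- sum over sets `W` of sinks collects them.
open Classical in
theorem extrapolatesTo_sum_strictColorings {R : Type*} [CommRing R] [Algebra ℚ R] (z : R)
    {D : Digraph V} (hD : IsAcyclic D) :
    ExtrapolatesTo (fun m => ∑ κ ∈ strictColorings D Finset.univ (m + 1),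
        z ^ (Finset.univ.filter fun v => κ v = m + 1).card)
      ((-1) ^ Fintype.card V * (1 - z) ^ (sinks D).card) := by
  simp only [sum_strictColorings_succ]
  rw [← sinksIn_univ, ← Finset.card_univ,
    ← sum_powerset_pow_mul_neg_one_pow z (sinksIn_subset D Finset.univ)]
  exact ExtrapolatesTo.sum fun W _ =>
    (ExtrapolatesTo.const _).mul (extrapolatesTo_card_strictColorings hD _)

end StrictColorings

/-! ### Specializing the variables -/

section Specialization

variable {R S : Type*} [CommRing R] [CommRing S] [Algebra R S]

/-- The weight of the `i`-th variable: `1` for `i ≤ m`, then `z` once, then `0`. -/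
def weight (m : ℕ) (z : S) (i : ℕ+) : S :=
  if (i : ℕ) ≤ m then 1 else if (i : ℕ) = m + 1 then z else 0

/-- The values `weight m z i * X` to be substituted for the variables `x i`. -/
noncomputable def weightedX (m : ℕ) (z : S) (i : ℕ+) : MvPowerSeries Unit S :=
  MvPowerSeries.C (weight m z i) * MvPowerSeries.X ()

theorem finite_le (m : ℕ) : {i : ℕ+ | (i : ℕ) ≤ m}.Finite :=
  (Set.finite_Iic m).preimage PNat.coe_injective.injOn

theorem weight_eq_zero {m : ℕ} {z : S} {i : ℕ+} (h : ¬ (i : ℕ) ≤ m + 1) : weight m z i = 0 := by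
  rw [weight, if_neg (by omega), if_neg (by omega)]

/-- The factor `X` kills the constant terms, and the weights vanish beyond `m + 1`; these are the
two conditions for substituting into a power series. -/
theorem hasSubst_weightedX (m : ℕ) (z : S) : MvPowerSeries.HasSubst (weightedX m z) where
  const_coeff i := by simp [weightedX]
  coeff_zero d := (finite_le (m + 1)).subset fun i hi => by
    by_contra h
    exact hi (by simp [weightedX, weight_eq_zero h])

theorem substAlgHom_weightedX_C (m : ℕ) (z : S) (r : R) :
    MvPowerSeries.substAlgHom (hasSubst_weightedX m z) (MvPowerSeries.C r) =
      MvPowerSeries.C (algebraMap R S r) := by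
  rw [MvPowerSeries.c_eq_algebraMap, AlgHom.commutes, MvPowerSeries.algebraMap_apply]

theorem coeff_prod_weightedX (m : ℕ) (z : S) (d : ℕ+ →₀ ℕ) (e : Unit →₀ ℕ) :
    MvPowerSeries.coeff e (d.prod fun i k => weightedX m z i ^ k) =
      if e = Finsupp.single () d.degree then d.prod fun i k => weight m z i ^ k else 0 := by
  have h : (d.prod fun i k => weightedX m z i ^ k) =
      MvPowerSeries.C (d.prod fun i k => weight m z i ^ k) * MvPowerSeries.X () ^ d.degree := by
    simp only [weightedX, mul_pow, Finsupp.prod_mul, ← map_pow]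
    rw [Finsupp.prod, ← map_prod, Finsupp.prod, Finsupp.prod, Finset.prod_pow_eq_pow_sum]
    rfl
  rw [h, MvPowerSeries.coeff_C_mul, MvPowerSeries.coeff_X_pow]
  split_ifs <;> simp

-- Monomials involving a variable beyond `m + 1` are sent to `0`, so `f` may be replaced by a finite
-- sum of monomials that agrees with it on the first `m + 1` variables.
open Classical in
theorem coeff_subst_weightedX (m : ℕ) (z : S) {ι : Type*} (F : Finset ι) (g : ι → ℕ+ →₀ ℕ)
    (r : ι → R) (f : MvPowerSeries ℕ+ R)
    (hf : ∀ d : ℕ+ →₀ ℕ, (∀ i ∈ d.support, (i : ℕ) ≤ m + 1) →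
      MvPowerSeries.coeff d f = ∑ i ∈ F with g i = d, r i)
    (e : Unit →₀ ℕ) :
    MvPowerSeries.coeff e (MvPowerSeries.subst (weightedX m z) f) =
      ∑ i ∈ F, r i • if e = Finsupp.single () (g i).degree then
        (g i).prod fun i k => weight m z i ^ k else 0 := by
  rw [MvPowerSeries.coeff_subst (hasSubst_weightedX m z)]
  simp only [coeff_prod_weightedX]
  have hterm : ∀ d : ℕ+ →₀ ℕ, (MvPowerSeries.coeff d f • if e = Finsupp.single () d.degree then
      d.prod fun i k => weight m z i ^ k else 0) =
      ∑ i ∈ F with g i = d, r i • if e = Finsupp.single () (g i).degree then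
        (g i).prod fun i k => weight m z i ^ k else 0 := fun d => by
    have hr : ∀ i ∈ F.filter fun i => g i = d,
        (r i • if e = Finsupp.single () (g i).degree then
          (g i).prod fun i k => weight m z i ^ k else 0) =
        r i • if e = Finsupp.single () d.degree then
          d.prod fun i k => weight m z i ^ k else 0 := fun i hi => by
      rw [(Finset.mem_filter.1 hi).2]
    rw [Finset.sum_congr rfl hr, ← Finset.sum_smul]
    by_cases hd : ∀ i ∈ d.support, (i : ℕ) ≤ m + 1
    · rw [hf d hd]
    · push Not at hd
      obtain ⟨i, hi, him⟩ := hd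
      have : (d.prod fun i k => weight m z i ^ k) = 0 :=
        Finset.prod_eq_zero hi (by
          dsimp only
          rw [weight_eq_zero (by omega), zero_pow (Finsupp.mem_support_iff.1 hi)])
      simp [this]
  simp only [hterm]
  rw [finsum_eq_sum_of_support_subset (s := F.image g)]
  · exact Finset.sum_fiberwise_of_maps_to (fun i hi => Finset.mem_image_of_mem g hi) _
  · intro d hd
    by_contra h
    refine hd (Finset.sum_eq_zero fun i hi => ?_)
    rw [Finset.mem_filter] at hi
    exact absurd (Finset.mem_image.2 ⟨i, hi⟩) h

theorem degree_sum_single {ι : Type*} (s : Finset ι) (g : ι → ℕ+) :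
    (∑ i ∈ s, Finsupp.single (g i) 1).degree = s.card := by
  simp [map_sum]

theorem prod_sum_single {ι : Type*} (s : Finset ι) (g : ι → ℕ+) (a : ℕ+ → S) :
    ((∑ i ∈ s, Finsupp.single (g i) 1).prod fun i k => a i ^ k) = ∏ i ∈ s, a (g i) := by
  rw [← Finsupp.prod_finsetSum_index (by simp) (by simp [pow_add])]
  simp

/-- The subsets are split by whether they contain `m + 1`, the only index of weight `z`. -/
theorem sum_prod_weight (m : ℕ) (z : S) (d : ℕ) :
    ∑ s ∈ (finite_le (m + 1)).toFinset.powersetCard (d + 1), ∏ i ∈ s, weight m z i =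
      (m.choose (d + 1) : S) + z * (m.choose d : S) := by
  classical
  have hcard : (finite_le m).toFinset.card = m := by
    have : (finite_le m).toFinset.image (fun i : ℕ+ => (i : ℕ)) = Finset.Icc 1 m := by
      ext k
      simp only [Finset.mem_image, Set.Finite.mem_toFinset, Set.mem_ofPred_eq, Finset.mem_Icc]
      exact ⟨fun ⟨i, hi, hik⟩ => hik ▸ ⟨i.pos, hi⟩, fun h => ⟨⟨k, h.1⟩, h.2, rfl⟩⟩
    rw [← Finset.card_image_of_injective _ PNat.coe_injective, this, Nat.card_Icc,
      Nat.add_sub_cancel]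
  have hnot : m.succPNat ∉ (finite_le m).toFinset := by simp
  have hins : (finite_le (m + 1)).toFinset = insert m.succPNat (finite_le m).toFinset := by
    ext i
    simp only [Set.Finite.mem_toFinset, Set.mem_ofPred_eq, Finset.mem_insert, ← PNat.coe_inj,
      Nat.succPNat_coe]
    omega
  have hone : ∀ k, ∀ s ∈ (finite_le m).toFinset.powersetCard k, ∏ i ∈ s, weight m z i = 1 :=
    fun k s hs => Finset.prod_eq_one fun i hi => by
      have := (Finset.mem_powersetCard.1 hs).1 hi
      rw [weight, if_pos (by simpa using this)]
  have hdisj : ∀ k, ∀ s ∈ (finite_le m).toFinset.powersetCard k, m.succPNat ∉ s :=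
    fun k s hs h => hnot ((Finset.mem_powersetCard.1 hs).1 h)
  rw [hins, Finset.powersetCard_succ_insert hnot, Finset.sum_union, Finset.sum_image]
  · congr 1
    · rw [Finset.sum_congr rfl (hone _)]
      simp [hcard]
    · have : ∀ s ∈ (finite_le m).toFinset.powersetCard d,
          ∏ i ∈ insert m.succPNat s, weight m z i = z := fun s hs => by
        rw [Finset.prod_insert (hdisj d s hs), hone d s hs]
        simp [weight]
      rw [Finset.sum_congr rfl this]
      simp [hcard, mul_comm]
  · intro s hs t ht hst
    rw [← Finset.erase_insert (hdisj d s hs), ← Finset.erase_insert (hdisj d t ht)]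
    exact congrArg (fun u => u.erase m.succPNat) hst
  · rw [Finset.disjoint_left]
    intro s hs hs'
    obtain ⟨t, -, rfl⟩ := Finset.mem_image.1 hs'
    exact hdisj _ _ hs (Finset.mem_insert_self _ _)

theorem subst_elem (m : ℕ) (z : S) (d : ℕ) :
    MvPowerSeries.subst (weightedX m z) (elem R (d + 1)) =
      MvPowerSeries.C ((m.choose (d + 1) : S) + z * (m.choose d : S)) *
        (MvPowerSeries.X () : MvPowerSeries Unit S) ^ (d + 1) := by
  classical
  refine MvPowerSeries.ext fun e => ?_
  rw [coeff_subst_weightedX m z ((finite_le (m + 1)).toFinset.powersetCard (d + 1))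
    (fun s => ∑ i ∈ s, Finsupp.single i 1) (fun _ => 1)]
  · simp only [degree_sum_single, prod_sum_single, one_smul]
    rw [MvPowerSeries.coeff_C_mul, MvPowerSeries.coeff_X_pow, ← sum_prod_weight, Finset.sum_mul]
    refine Finset.sum_congr rfl fun s hs => ?_
    rw [(Finset.mem_powersetCard.1 hs).2]
    split_ifs <;> simp
  · intro x hx
    have hinj : ∀ s : Finset ℕ+, (∑ i ∈ s, Finsupp.single i 1 : ℕ+ →₀ ℕ).support = s := fun s => by
      ext j
      simp [Finsupp.finsetSum_apply, Finsupp.single_apply]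
    have hcoeff : MvPowerSeries.coeff x (elem R (d + 1)) =
        if ∃ s : Finset ℕ+, s.card = d + 1 ∧ ∑ i ∈ s, Finsupp.single i 1 = x then 1 else 0 := by
      simp only [MvPowerSeries.coeff_apply, elem]
    rw [hcoeff]
    split_ifs with h
    · obtain ⟨s, hs, rfl⟩ := h
      rw [hinj] at hx
      rw [Finset.sum_eq_single_of_mem s]
      · simp only [Finset.mem_filter, Finset.mem_powersetCard, and_true]
        exact ⟨fun i hi => by simpa using hx i hi, hs⟩
      · intro t ht hts
        refine absurd ?_ hts
        rw [← hinj t, ← hinj s, (Finset.mem_filter.1 ht).2]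
    · rw [Finset.filter_eq_empty_iff.2, Finset.sum_empty]
      exact fun s hs hsx => h ⟨s, (Finset.mem_powersetCard.1 hs).2, hsx⟩

theorem multiset_prod_map_pow {M : Type*} [CommMonoid M] (x : M) (s : Multiset ℕ) :
    (s.map fun d => x ^ d).prod = x ^ s.sum := by
  induction s using Multiset.induction_on with
  | empty => simp
  | cons d s ih => rw [Multiset.map_cons, Multiset.prod_cons, ih, Multiset.sum_cons, pow_add]

theorem subst_elemPart (m : ℕ) (z : S) {n : ℕ} (μ : n.Partition) :
    MvPowerSeries.subst (weightedX m z) (elemPart R μ) =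
      MvPowerSeries.C (μ.parts.map fun d => (m.choose d : S) + z * (m.choose (d - 1) : S)).prod *
        (MvPowerSeries.X () : MvPowerSeries Unit S) ^ n := by
  have h : ∀ d ∈ μ.parts, MvPowerSeries.substAlgHom (hasSubst_weightedX m z) (elem R d) =
      MvPowerSeries.C ((m.choose d : S) + z * (m.choose (d - 1) : S)) *
        (MvPowerSeries.X () : MvPowerSeries Unit S) ^ d := fun d hd => by
    -- Parts are positive, so the truncated `d - 1` is a true predecessor.
    obtain ⟨d, rfl⟩ := Nat.exists_eq_succ_of_ne_zero (μ.parts_pos hd).ne'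
    rw [MvPowerSeries.substAlgHom_apply]
    exact subst_elem m z d
  rw [← MvPowerSeries.substAlgHom_apply (hasSubst_weightedX m z), elemPart, map_multiset_prod,
    Multiset.map_map]
  simp only [Function.comp_def]
  rw [Multiset.map_congr rfl h, Multiset.prod_map_mul, multiset_prod_map_pow, μ.parts_sum,
    map_multiset_prod, Multiset.map_map]
  rfl

end Specialization

/-- The orientation of the edges of `H` towards the larger value of `κ`. -/
def orientationOf {V : Type*} (H : SimpleGraph V) (κ : V → ℕ) : Digraph V where
  Adj u v := H.Adj u v ∧ κ u < κ v

theorem isAcyclic_orientationOf {V : Type*} (H : SimpleGraph V) (κ : V → ℕ) :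
    IsAcyclic (orientationOf H κ) := by
  have h : ∀ u v, Relation.TransGen (orientationOf H κ).Adj u v → κ u < κ v := fun u v huv => by
    induction huv with
    | single h => exact h.2
    | tail _ h ih => exact ih.trans h.2
  exact fun v hv => lt_irrefl _ (h v v hv)

theorem eq_orientationOf {V : Type*} {H : SimpleGraph V} {D : Digraph V} (hD : IsOrientation H D)
    {κ : V → ℕ} (hκ : ∀ u v, D.Adj u v → κ u < κ v) : D = orientationOf H κ := by
  ext u v
  refine ⟨fun h => ⟨hD.1 u v h, hκ u v h⟩, fun h => ?_⟩
  rcases hD.2 u v h.1 with h' | h'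
  · exact h'.1
  · exact absurd (hκ v u h'.1) h.2.asymm

/-! ### Proper colorings grouped by acyclic orientation -/

section Colorings

variable {V : Type*} [Fintype V]

theorem content_apply_ne_zero {G : Digraph V} {κ : ProperColoring G} {i : ℕ+} :
    content κ i ≠ 0 ↔ ∃ v, κ v = i := by
  simp [content, Finsupp.finsetSum_apply, Finsupp.single_apply]

theorem finite_coloring_le (G : Digraph V) (m : ℕ) :
    {κ : ProperColoring G | ∀ v, (κ v : ℕ) ≤ m}.Finite := by
  refine Set.Finite.of_finite_image (f := fun κ : ProperColoring G => (κ : V → ℕ+))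
    ((Set.Finite.pi fun _ : V => finite_le m).subset ?_) DFunLike.coe_injective.injOn
  rintro _ ⟨κ, hκ, rfl⟩ v -
  exact hκ v

open Classical in
theorem subst_chromQSym {S : Type*} [CommRing S] [Algebra ℚ[X] S] (G : Digraph V) (m : ℕ) (z : S) :
    MvPowerSeries.subst (weightedX m z) (chromQSym G) =
      MvPowerSeries.C (∑ κ ∈ (finite_coloring_le G (m + 1)).toFinset,
        algebraMap ℚ[X] S Polynomial.X ^ asc G κ *
          z ^ (Finset.univ.filter fun v => (κ v : ℕ) = m + 1).card) *
        (MvPowerSeries.X () : MvPowerSeries Unit S) ^ Fintype.card V := by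
  refine MvPowerSeries.ext fun e => ?_
  rw [coeff_subst_weightedX m z (finite_coloring_le G (m + 1)).toFinset content
    (fun κ => Polynomial.X ^ asc G κ)]
  · rw [MvPowerSeries.coeff_C_mul, MvPowerSeries.coeff_X_pow, Finset.sum_mul]
    refine Finset.sum_congr rfl fun κ hκ => ?_
    rw [Set.Finite.mem_toFinset, Set.mem_ofPred_eq] at hκ
    have hw : ∀ v, weight m z (κ v) = if (κ v : ℕ) = m + 1 then z else 1 := fun v => by
      have := hκ v
      rw [weight]
      split_ifs <;> first | rfl | omega
    rw [content, degree_sum_single, prod_sum_single, Algebra.smul_def, map_pow, mul_assoc,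
      Finset.card_univ]
    simp only [hw]
    rw [Finset.prod_ite, Finset.prod_const, Finset.prod_const_one, mul_one]
    split_ifs <;> simp
  · intro d hd
    rw [MvPowerSeries.coeff_apply, chromQSym]
    refine Finset.sum_congr ?_ fun _ _ => rfl
    ext κ
    simp only [Set.Finite.mem_toFinset, Set.mem_ofPred_eq, Finset.mem_filter]
    refine ⟨fun h => ⟨fun v => hd _ ?_, h⟩, fun h => h.2⟩
    rw [Finsupp.mem_support_iff, ← h, content_apply_ne_zero]
    exact ⟨v, rfl⟩

open Classical in
/-- Each proper coloring is a strict coloring of exactly one acyclic orientation. -/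
theorem sum_coloring_eq_sum_orientation {S : Type*} [CommRing S] {G : Digraph V}
    (hloop : ∀ v, ¬ G.Adj v v) (t : S) (m : ℕ) (w : (V → ℕ) → S) :
    ∑ κ ∈ (finite_coloring_le G m).toFinset, t ^ asc G κ * w (fun v => κ v) =
      ∑ D : Digraph V with IsOrientation G.toSimpleGraphInclusive D ∧ IsAcyclic D,
        t ^ ascOrientation G D * ∑ κ ∈ strictColorings D Finset.univ m, w κ := by
  simp only [Finset.mul_sum]
  rw [Finset.sum_sigma']
  refine Finset.sum_bij (fun κ _ => ⟨orientationOf G.toSimpleGraphInclusive fun v => κ v,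
    fun v => κ v⟩) ?_ ?_ ?_ ?_
  · intro κ hκ
    rw [Set.Finite.mem_toFinset, Set.mem_ofPred_eq] at hκ
    simp only [Finset.mem_sigma, Finset.mem_filter, Finset.mem_univ, true_and,
      mem_strictColorings]
    refine ⟨⟨⟨fun u v h => h.1, fun u v h => ?_⟩, isAcyclic_orientationOf _ _⟩,
      fun v _ => ⟨(κ v).pos, hκ v⟩, fun v hv => absurd trivial hv, fun u _ v _ h => h.2⟩
    have hne : (κ u : ℕ) ≠ κ v := fun h' => κ.valid h (PNat.coe_injective h')
    rcases hne.lt_or_gt with h' | h'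
    · exact Or.inl ⟨⟨h, h'⟩, fun h'' => h'.asymm h''.2⟩
    · exact Or.inr ⟨⟨h.symm, h'⟩, fun h'' => h'.asymm h''.2⟩
  · intro κ₁ _ κ₂ _ h
    have h' := congrArg Sigma.snd h
    exact DFunLike.ext _ _ fun v => PNat.coe_injective (congrFun h' v)
  · rintro ⟨D, κ⟩ h
    simp only [Finset.mem_sigma, Finset.mem_filter, Finset.mem_univ, true_and,
      mem_strictColorings, not_true_eq_false, false_imp_iff, implies_true,
      forall_const] at h
    obtain ⟨⟨hD, -⟩, hκ, hlt⟩ := h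
    refine ⟨SimpleGraph.Coloring.mk (fun v => ⟨κ v, (hκ v).1⟩) ?_, ?_, ?_⟩
    · intro u v huv heq
      have heq' : κ u = κ v := congrArg PNat.val heq
      rcases hD.2 u v huv with h | h
      · exact (hlt u v h.1).ne heq'
      · exact (hlt v u h.1).ne heq'.symm
    · rw [Set.Finite.mem_toFinset]
      exact fun v => (hκ v).2
    · exact Sigma.ext (eq_orientationOf hD hlt).symm HEq.rfl
  · intro κ _
    have hasc : asc G κ = ascOrientation G
        (orientationOf G.toSimpleGraphInclusive fun v => κ v) := by
      unfold asc ascOrientation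
      congr 1
      ext ⟨u, v⟩
      rw [Finset.mem_filter, Finset.mem_filter]
      refine and_congr_right fun _ => and_congr_right fun h => ⟨fun h' => ⟨?_, h'⟩, fun h' => h'.2⟩
      -- The underlying simple graph forgets loops, so the ends of the edge must be shown distinct.
      refine (SimpleGraph.fromRel_adj _ _ _).2 ⟨?_, Or.inl h⟩
      have huv : G.Adj u v := h
      exact fun (heq : u = v) => hloop v (heq ▸ huv)
    rw [hasc]

end Colorings

/-! ### Comparison at `m = -1` -/

theorem multiset_prod_map_neg_one_pow_mul {R : Type*} [CommRing R] (y : R) (s : Multiset ℕ) :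
    (s.map fun d => (-1) ^ d * y).prod = (-1) ^ s.sum * y ^ s.card := by
  rw [Multiset.prod_map_mul, multiset_prod_map_pow, Multiset.map_const', Multiset.prod_replicate]

open Classical in
/-- Evaluating at `z` and at `-1` further variables equal to `1` sends `e_μ` to
`(-1) ^ n * (1 - z) ^ ℓ(μ)` and the colorings belonging to an acyclic orientation to
`(-1) ^ n * (1 - z) ^ #sinks`. -/
theorem sum_mul_pow_card_parts_eq {V : Type*} [Fintype V] {G : Digraph V}
    (hloop : ∀ v, ¬ G.Adj v v) {c : (Fintype.card V).Partition → ℚ[X]}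
    (hc : chromQSym G = ∑ μ, MvPowerSeries.C (c μ) * elemPart ℚ[X] μ)
    {S : Type*} [CommRing S] [IsDomain S] [Algebra ℚ[X] S] [Algebra ℚ S] (y : S) :
    ∑ μ, algebraMap ℚ[X] S (c μ) * y ^ μ.parts.card =
      ∑ D : Digraph V with IsOrientation G.toSimpleGraphInclusive D ∧ IsAcyclic D,
        algebraMap ℚ[X] S Polynomial.X ^ ascOrientation G D * y ^ (sinks D).card := by
  have key : ∀ m : ℕ,
      ∑ μ, algebraMap ℚ[X] S (c μ) *
        (μ.parts.map fun d => (m.choose d : S) + (1 - y) * (m.choose (d - 1) : S)).prod =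
      ∑ D : Digraph V with IsOrientation G.toSimpleGraphInclusive D ∧ IsAcyclic D,
        algebraMap ℚ[X] S Polynomial.X ^ ascOrientation G D *
          ∑ κ ∈ strictColorings D Finset.univ (m + 1),
            (1 - y) ^ (Finset.univ.filter fun v => κ v = m + 1).card := fun m => by
    have h := congrArg (MvPowerSeries.substAlgHom (hasSubst_weightedX m (1 - y))) hc
    simp only [map_sum, map_mul, substAlgHom_weightedX_C] at h
    simp only [MvPowerSeries.substAlgHom_apply, subst_chromQSym, subst_elemPart, ← mul_assoc] at h
    simp only [← map_mul, ← Finset.sum_mul, ← map_sum] at h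
    -- Both sides are now constants times `X^n`; the coefficient of `X^n` recovers the constants.
    have h' := congrArg
      (MvPowerSeries.coeff (Finsupp.single () (Fintype.card V))) h
    simp only [MvPowerSeries.coeff_C_mul, MvPowerSeries.coeff_X_pow, if_true, mul_one] at h'
    rw [← h']
    exact (sum_coloring_eq_sum_orientation hloop _ (m + 1)
      fun κ => (1 - y) ^ (Finset.univ.filter fun v => κ v = m + 1).card)
  have hparts : ∀ μ : (Fintype.card V).Partition,
      ExtrapolatesTo (fun m => (μ.parts.map fun d =>
        (m.choose d : S) + (1 - y) * (m.choose (d - 1) : S)).prod)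
        ((-1) ^ Fintype.card V * y ^ μ.parts.card) := fun μ => by
    have hμ := multiset_prod_map_neg_one_pow_mul y μ.parts
    rw [μ.parts_sum] at hμ
    rw [← hμ]
    refine ExtrapolatesTo.multiset_prod fun d hd => ?_
    obtain ⟨d, rfl⟩ := Nat.exists_eq_succ_of_ne_zero (μ.parts_pos hd).ne'
    have hd := (extrapolatesTo_choose (R := S) (d + 1)).add
      ((ExtrapolatesTo.const (1 - y)).mul (extrapolatesTo_choose d))
    rwa [show (-1 : S) ^ (d + 1) + (1 - y) * (-1) ^ d = (-1) ^ (d + 1) * y by ring] at hd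
  have hleft := ExtrapolatesTo.sum (s := Finset.univ) fun μ _ =>
    (ExtrapolatesTo.const (algebraMap ℚ[X] S (c μ))).mul (hparts μ)
  have hright := ExtrapolatesTo.sum (s := Finset.univ.filter fun D : Digraph V =>
      IsOrientation G.toSimpleGraphInclusive D ∧ IsAcyclic D) fun D hD =>
    (ExtrapolatesTo.const (algebraMap ℚ[X] S Polynomial.X ^ ascOrientation G D)).mul
      (extrapolatesTo_sum_strictColorings (1 - y) (Finset.mem_filter.1 hD).2.2)
  simp only [key] at hleft
  -- By `key` both extrapolations concern the same function of `m`, so their values at `-1` agree;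
  -- the unit `(-1)^n` then cancels.
  have h := hleft.unique hright
  simp only [sub_sub_cancel, mul_left_comm _ ((-1 : S) ^ Fintype.card V), ← Finset.mul_sum] at h
  exact ((isUnit_one.neg.pow _).mul_right_inj).1 h

end ChromaticQSym

theorem theorem6p5 {V : Type*} [Fintype V] (G : Digraph V) (hloop : ∀ v, ¬ G.Adj v v)
    (hsymm : ChromaticQSym.IsSymm (ChromaticQSym.chromQSym G))
    (c : (Fintype.card V).Partition → ℚ[X])
    (hc : ChromaticQSym.chromQSym G =
      ∑ μ, MvPowerSeries.C (c μ) * ChromaticQSym.elemPart ℚ[X] μ)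
    (k : ℕ) :
    ∑ μ : (Fintype.card V).Partition with μ.parts.card = k, c μ =
      ∑ D ∈ ChromaticQSym.acyclicOrientations G.toSimpleGraphInclusive k,
        (Polynomial.X : ℚ[X]) ^ ChromaticQSym.ascOrientation G D := by
  classical
  -- Taking `y` to be a fresh indeterminate over `ℚ[t]` lets the coefficient of `y^k` select `k`
  -- parts on one side and `k` sinks on the other.
  have h := congrArg (fun p => Polynomial.coeff p k)
    (ChromaticQSym.sum_mul_pow_card_parts_eq hloop hc (S := ℚ[X][X]) Polynomial.X)
  simp only [Polynomial.finsetSum_coeff, Polynomial.algebraMap_apply, Algebra.algebraMap_self,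
    RingHom.id_apply, ← Polynomial.C_pow, Polynomial.coeff_C_mul, Polynomial.coeff_X_pow,
    mul_ite, mul_one, mul_zero] at h
  rw [Finset.sum_filter]
  simp only [eq_comm (b := k)]
  rw [ChromaticQSym.acyclicOrientations]
  simp only [eq_comm (b := k), ← and_assoc]
  rw [h, ← Finset.sum_filter, Finset.filter_filter]
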